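/- Let $q$ be a power of $2$ and let $b\in\mathbb{F}_{q^6}$. Consider the $\mathbb{F}_q$-subspace \[U_b=\{(x,\,bx^q+x^{q^4}) : x\in\mathbb{F}_{q^6}\}\] of $\mathbb{F}_{q^6}\times\mathbb{F}_{q^6}$. Here an $\mathbb{F}_q$-subspace $U$ of $\mathbb{F}_{q^6}\times\mathbb{F}_{q^6}$ is called scattered if it meets every one-dimensional $\mathbb{F}_{q^6}$-subspace in an $\mathbb{F}_q$-subspace of dimension at most one, and maximum scattered if it is scattered and $\dim_{\mathbb{F}_q}U=6$. Put \[N=\mathrm{N}_{q^6/q^3}(b)=b^{q^3+1}\in\mathbb{F}_{q^3},\quad A=b^{q+1},\quad B=N^{q^2+q+1}+N+N^q+N^{q^2},\quad C=A^{q^3}(N+1)^{q^2+q+1}.\] If $B\neq 0$, then $AC/B^2\in\mathbb{F}_{q^3}$. Moreover, $U_b$ is a maximum scattered $\mathbb{F}_q$-subspace of $\mathbb{F}_{q^6}\times\mathbb{F}_{q^6}$ if and only if \[B\neq 0,\qquad N\in\mathbb{F}_{q^3}\setminus\{0,1\},\qquad \mathrm{Tr}_{q^3/2}(AC/B^2)=0,\]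 where $\mathrm{Tr}_{q^3/2}$ denotes the trace from $\mathbb{F}_{q^3}$ to $\mathbb{F}_2$. -/

import Mathlib

/-- An `F`-subspace `U` of a `K`-vector space `V` is scattered (with respect to the Desarguesian
spread) if it meets every one-dimensional `K`-subspace of `V` in an `F`-subspace of dimension
at most one. -/
def IsScattered (F K : Type*) {V : Type*} [Field F] [Field K] [Algebra F K]
    [AddCommGroup V] [Module F V] [Module K V] [IsScalarTower F K V]
    (U : Submodule F V) : Prop :=
  ∀ u : V, u ≠ 0 →
    Module.finrank F ↥(U ⊓ (Submodule.span K {u}).restrictScalars F) ≤ 1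

/-- A scattered `F`-subspace of an `r`-dimensional `K`-vector space `V`, with `[K : F] = n`, is
maximum scattered if its `F`-dimension is `r * n / 2`. -/
def IsMaximumScattered (F K : Type*) {V : Type*} [Field F] [Field K] [Algebra F K]
    [AddCommGroup V] [Module F V] [Module K V] [IsScalarTower F K V]
    (U : Submodule F V) : Prop :=
  IsScattered F K U ∧
    2 * Module.finrank F U = Module.finrank K V * Module.finrank F K

/-- The `F`-subspace `{(x, b * x ^ q + x ^ (q ^ 4)) : x ∈ K}` of `K × K`, where `q = |F|`. -/
def scatteredU (F : Type*) {K : Type*} [Field F] [Finite F] [Field K] [Algebra F K] (b : K) :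
    Submodule F (K × K) where
  carrier := {v | ∃ x : K, v = (x, b * x ^ Nat.card F + x ^ (Nat.card F ^ 4))}
  zero_mem' := ⟨0, by simp [Nat.card_pos.ne', Prod.ext_iff]⟩
  add_mem' := by
    have := Fintype.ofFinite F
    rintro _ _ ⟨x, rfl⟩ ⟨y, rfl⟩
    refine ⟨x + y, ?_⟩
    have h1 : ∀ u v : K, (u + v) ^ Nat.card F = u ^ Nat.card F + v ^ Nat.card F := fun u v => by
      rw [Nat.card_eq_fintype_card]
      exact map_add (FiniteField.frobeniusAlgHom F K) u v
    have h4 : (x + y) ^ (Nat.card F ^ 4) = x ^ (Nat.card F ^ 4) + y ^ (Nat.card F ^ 4) := by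
      simp only [pow_succ (Nat.card F), pow_zero, one_mul, pow_mul, h1]
    simp only [Prod.mk_add_mk, Prod.mk.injEq, true_and, h1, h4]
    ring
  smul_mem' := by
    have := Fintype.ofFinite F
    rintro c _ ⟨x, rfl⟩
    refine ⟨c • x, ?_⟩
    have h1 : ∀ u : K, (c • u) ^ Nat.card F = c • u ^ Nat.card F := fun u => by
      rw [Nat.card_eq_fintype_card]
      exact map_smul (FiniteField.frobeniusAlgHom F K) c u
    have h4 : (c • x) ^ (Nat.card F ^ 4) = c • x ^ (Nat.card F ^ 4) := by
      simp only [pow_succ (Nat.card F), pow_zero, one_mul, pow_mul, h1]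
    simp only [Prod.smul_mk, h1, h4, smul_add, mul_smul_comm]

/-- An intermediate field of an extension of a field of characteristic `p` has
characteristic `p`. -/
instance intermediateFieldCharP {F K : Type*} [Field F] [Field K] [Algebra F K]
    (L : IntermediateField F K) (p : ℕ) [CharP F p] : CharP L p :=
  charP_of_injective_algebraMap (algebraMap F L).injective p

/-- The absolute trace of a field of characteristic `p`, that is, its trace down to the prime
field `ZMod p`. -/
noncomputable def absTrace (p : ℕ) {L : Type*} [Field L] [CharP L p] (x : L) : ZMod p :=
  letI := ZMod.algebra L p
  Algebra.trace (ZMod p) L x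

/-!
Write `s` for the Frobenius `x ↦ x ^ q` and `xᵢ` for the `i`-fold application of `s` to `x`. The
field `L` is the fixed field of `s ^ 3`, and `N = b b₃`.

The subspace `U_b` fails to be scattered exactly when, for some `m`, the equation
`b x₁ + x₄ = m x` has two `F`-independent solutions (`isMaximumScattered_scatteredU_iff`). If
`N = 0` or `N = 1` this happens, with `m = 1` or `m = 0`. Otherwise put `Φ x = (b x₁ + x₄) / m`; it is
an `s`-semilinear map of the plane `K` over `L`, and its cube is `x ↦ P x₃ + Q x`. Two `F`-independent
fixed points of `Φ` span `K` over `L`, so they force `P = 0` (`cubic_coeff_eq_zero`). Conversely, if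
`P = 0` then `Q` lies in `F`, and after rescaling `m` by an element of `L` of norm `Q` the cube of
`Φ` is the identity, so that descent provides two independent fixed points
(`exists_eigen_pair_of_cubic_coeff`).

In terms of `k = m₁ / (m₄ b b₁)`, for which `N N₁ k k₃ = 1`, the equation `P = 0` becomes the Möbius
relation `k₁ = (1 + k) / (1 + N₁ k)`, and Hilbert 90 recovers `m` from `k`. Iterating the relation
three times gives the quadratic equation `N N₁ (1 + N₂) k² + B k + (1 + N₂) = 0`, whose roots are
`k` and `k₃`. If `B = 0` its double root solves the Möbius relation. If `B ≠ 0`, the element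
`h = N N₁ (1 + N₂) (k + 1) / B` satisfies `h² + h = A C / B²` with `h₃ ≠ h`, so the roots of this
Artin–Schreier equation lie outside `L`, which means that the absolute trace of `A C / B²` is one.
Conversely, a root `h` outside `L` yields a root `k` of the quadratic. The Möbius image of `k` is
then `k₁` or `k₄`, and the latter is excluded because `s ^ 4` has order three, which would give
`k₃ = k`.
-/

/-! ### The Möbius recursion and its quadratic equation in characteristic two -/

/-- The third iterate of the Möbius recursion `kᵢ₊₁ = (1 + kᵢ) / (1 + Nᵢ₊₁ kᵢ)`, with indices of
`N` read modulo 3. It is stated without denominators and needs no nonvanishing hypothesis. -/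
theorem mobius_iterate {K : Type*} [Field K] [CharP K 2] {N₀ N₁ N₂ k k₁ k₂ k₃ : K}
    (h₁ : 1 + k + k₁ + N₁ * k * k₁ = 0) (h₂ : 1 + k₁ + k₂ + N₂ * k₁ * k₂ = 0)
    (h₃ : 1 + k₂ + k₃ + N₀ * k₂ * k₃ = 0) :
    k₃ * (1 + N₂ + (N₀ + N₀ * N₁ + N₁ + N₂) * k) = (1 + N₂) * (1 + k) := by
  have two : (2 : K) = 0 := CharTwo.two_eq_zero
  have e₁ : (1 + N₁) * k + k₂ * (1 + N₂ + (N₁ + N₂) * k) = 0 := by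
    linear_combination (1 + N₁ * k) * h₂ - (1 + N₂ * k₂) * h₁ + (N₂ * k₂ + N₂ * k * k₂ + k) * two
  linear_combination (1 + N₂ + (N₁ + N₂) * k) * h₃ - (1 + N₀ * k₃) * e₁ +
    ((1 + N₁) * k * N₀ * k₃ - 1 - N₂ - N₂ * k) * two

/-- If the third iterate of the Möbius recursion is `1 / (N₀ N₁ k)`, then `k` is a root of a
quadratic polynomial, whose middle coefficient is the quantity `B` of the theorem. -/
theorem quadratic_of_mobius {K : Type*} [Field K] [CharP K 2] {N₀ N₁ N₂ k k₁ k₂ k₃ : K}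
    (h₁ : 1 + k + k₁ + N₁ * k * k₁ = 0) (h₂ : 1 + k₁ + k₂ + N₂ * k₁ * k₂ = 0)
    (h₃ : 1 + k₂ + k₃ + N₀ * k₂ * k₃ = 0) (hk : N₀ * N₁ * (k * k₃) = 1) :
    N₀ * N₁ * (1 + N₂) * k ^ 2 + (N₀ * N₁ * N₂ + N₀ + N₁ + N₂) * k + (1 + N₂) = 0 := by
  have two : (2 : K) = 0 := CharTwo.two_eq_zero
  have := mobius_iterate h₁ h₂ h₃
  grind

/-- The substitution that turns the quadratic for `k` into an Artin–Schreier equation. -/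
theorem artin_schreier_of_quadratic {K : Type*} [Field K] [CharP K 2] {N₀ N₁ N₂ B k : K}
    (hB : B ≠ 0) (hB' : B = N₀ * N₁ * N₂ + N₀ + N₁ + N₂)
    (h : N₀ * N₁ * (1 + N₂) * k ^ 2 + B * k + (1 + N₂) = 0) :
    (N₀ * N₁ * (1 + N₂) * (k + 1) / B) ^ 2 + N₀ * N₁ * (1 + N₂) * (k + 1) / B =
      N₀ * N₁ * ((N₀ + 1) * (N₁ + 1) * (N₂ + 1)) / B ^ 2 := by
  have two : (2 : K) = 0 := CharTwo.two_eq_zero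
  field_simp
  grind

theorem quadratic_of_artin_schreier {K : Type*} [Field K] [CharP K 2] {N₀ N₁ N₂ B k : K}
    (hB : B ≠ 0) (hB' : B = N₀ * N₁ * N₂ + N₀ + N₁ + N₂) (h0 : N₀ ≠ 0) (h1 : N₁ ≠ 0)
    (h2 : 1 + N₂ ≠ 0)
    (h : (N₀ * N₁ * (1 + N₂) * (k + 1) / B) ^ 2 + N₀ * N₁ * (1 + N₂) * (k + 1) / B =
      N₀ * N₁ * ((N₀ + 1) * (N₁ + 1) * (N₂ + 1)) / B ^ 2) :
    N₀ * N₁ * (1 + N₂) * k ^ 2 + B * k + (1 + N₂) = 0 := by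
  have two : (2 : K) = 0 := CharTwo.two_eq_zero
  have h' : (1 + N₂) * (N₀ * N₁ * (1 + N₂) * k ^ 2 + B * k + (1 + N₂)) = 0 := by
    field_simp at h
    clear h0 h1 h2 hB
    grind
  exact (mul_eq_zero.1 h').resolve_left h2

/-- If `k` is a root of the quadratic polynomial of `quadratic_of_mobius` and `k₁`, `k₄` are the two
roots of its Frobenius conjugate, then the Möbius map sends `k` to `k₁` or to `k₄`: the product of
the two defects is a multiple of the quadratic polynomial at `k`. -/
theorem mobius_pair {K : Type*} [Field K] [CharP K 2] {N₀ N₁ N₂ B k k₁ k₄ : K}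
    (hB : B = N₀ * N₁ * N₂ + N₀ + N₁ + N₂) (h1 : N₁ ≠ 0) (h2 : N₂ ≠ 0) (h0 : 1 + N₀ ≠ 0)
    (h : N₀ * N₁ * (1 + N₂) * k ^ 2 + B * k + (1 + N₂) = 0)
    (hs : N₁ * N₂ * (1 + N₀) * (k₁ + k₄) = B) (hp : N₁ * N₂ * (k₁ * k₄) = 1) :
    1 + k + k₁ + N₁ * k * k₁ = 0 ∨ 1 + k + k₄ + N₁ * k * k₄ = 0 := by
  have two : (2 : K) = 0 := CharTwo.two_eq_zero
  have h' : N₁ * N₂ * (1 + N₀) *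
      ((1 + k + k₁ + N₁ * k * k₁) * (1 + k + k₄ + N₁ * k * k₄)) = 0 := by
    have e : N₁ * N₂ * (1 + N₀) *
      ((1 + k + k₁ + N₁ * k * k₁) * (1 + k + k₄ + N₁ * k * k₄)) =
      N₁ * N₂ * (1 + N₀) * (1 + k) ^ 2 + B * (1 + k) * (1 + N₁ * k) +
        (1 + N₀) * (1 + N₁ * k) ^ 2 := by
      linear_combination (1 + k) * (1 + N₁ * k) * hs + (1 + N₀) * (1 + N₁ * k) ^ 2 * hp
    rw [e]
    subst hB
    clear hs hp e
    grind
  have : N₁ * N₂ * (1 + N₀) ≠ 0 := mul_ne_zero (mul_ne_zero h1 h2) h0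
  exact mul_eq_zero.1 ((mul_eq_zero.1 h').resolve_left this)

/-! ### Semilinear algebra of an endomorphism of order six -/

section SixCycle

variable {K : Type*} [Field K] {s : K →+* K}

/-- Hilbert's theorem 90 for the involution `s ^ 3`, in the shape `ρ = s m / s ^ 4 m`. -/
theorem exists_div_conj_eq [CharP K 2] (h6 : ∀ x, s (s (s (s (s (s x))))) = x) {ρ : K}
    (hρ : ρ * s (s (s ρ)) = 1) : ∃ m : K, m ≠ 0 ∧ s m = ρ * s (s (s (s m))) := by
  have two : (2 : K) = 0 := CharTwo.two_eq_zero
  obtain ⟨n, hn, h⟩ : ∃ n : K, n ≠ 0 ∧ n = ρ * s (s (s n)) := by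
    by_cases h1 : ρ = 1
    · exact ⟨1, one_ne_zero, by simp [h1]⟩
    -- `1 + ρ` is the resolvent `c + ρ * s ^ 3 c` at `c = 1`.
    · refine ⟨1 + ρ, fun h => h1 ?_, ?_⟩
      · linear_combination h - two
      · simp only [map_add, map_one]
        linear_combination -hρ
  refine ⟨s (s (s (s (s n)))), by simpa using hn, ?_⟩
  simpa only [h6] using h

/-- Let `Φ x = (b * s x + s ^ 4 x) / m`. Then `Φ ^ 3` has the form `x ↦ P * s ^ 3 x + Q * x`. If `Φ`
has two fixed points `x`, `y` whose ratio is not fixed by `s`, then that ratio is not fixed by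
`s ^ 3` either, and this forces `P = 0`. The displayed sum is `P` without its denominator. -/
theorem cubic_coeff_eq_zero [CharP K 2] (h6 : ∀ x, s (s (s (s (s (s x))))) = x) {b m x y : K}
    (hN : b * s (s (s b)) ≠ 1) (hx : x ≠ 0) (hy : y * s x ≠ s y * x)
    (hmx : b * s x + s (s (s (s x))) = m * x) (hmy : b * s y + s (s (s (s y))) = m * y) :
    m ≠ 0 ∧ b * s b * s (s b) * s (s (s (s m))) * s (s (s (s (s m)))) +
      s (s b) * s m * s (s (s (s (s m)))) + b * s (s m) * s (s (s (s m))) +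
      s (s (s (s b))) * s m * s (s m) = 0 := by
  have two : (2 : K) = 0 := CharTwo.two_eq_zero
  -- The equation `x = Φ ^ 3 x`, cleared of denominators.
  have key : ∀ x : K, b * s x + s (s (s (s x))) = m * x →
      s (s (s x)) * (b * s b * s (s b) * s (s (s (s m))) * s (s (s (s (s m)))) +
      s (s b) * s m * s (s (s (s (s m)))) + b * s (s m) * s (s (s (s m))) +
      s (s (s (s b))) * s m * s (s m)) =
      x * (m * s m * s (s m) * s (s (s (s m))) * s (s (s (s (s m)))) -
      (b * s b * s (s (s (s m))) * s (s (s (s (s m)))) + s m * s (s (s (s (s m)))) +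
       b * s (s (s (s (s b)))) * s (s m) * s (s (s (s m))) +
       s (s (s (s b))) * s (s (s (s (s b)))) * s m * s (s m))) := by
    intro x h
    have e₁ := congrArg s h
    have e₂ := congrArg s e₁
    have e₃ := congrArg s e₂
    have e₄ := congrArg s e₃
    have e₅ := congrArg s e₄
    simp only [map_add, map_mul, h6] at e₁ e₂ e₃ e₄ e₅
    generalize s (s (s (s (s x)))) = x₅ at *
    generalize s (s (s (s x))) = x₄ at *
    generalize s (s (s x)) = x₃ at *
    generalize s (s x) = x₂ at *
    generalize s x = x₁ at *
    generalize s (s (s (s (s m)))) = m₅ at *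
    generalize s (s (s (s m))) = m₄ at *
    generalize s (s (s m)) = m₃ at *
    generalize s (s m) = m₂ at *
    generalize s m = m₁ at *
    generalize s (s (s (s (s b)))) = b₅ at *
    generalize s (s (s (s b))) = b₄ at *
    generalize s (s (s b)) = b₃ at *
    generalize s (s b) = b₂ at *
    generalize s b = b₁ at *
    linear_combination m₁ * m₂ * m₄ * m₅ * h + b * m₄ * m₂ * m₅ * e₁ + m₁ * m₂ * m₅ * e₄ +
      (b * b₁ * m₄ + m₁) * m₅ * e₂ + (b * m₄ + b₄ * m₁) * m₂ * e₅
  -- For `m = 0`, applying `s ^ 3` to the equation for `x` shows that `b` has norm one.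
  have hm : m ≠ 0 := by
    rintro rfl
    have e := congrArg (fun z => s (s (s z))) hmx
    simp only [map_add, map_mul, h6, map_zero, zero_mul] at hmx e
    have : s x ≠ 0 := by simpa using hx
    refine hN (mul_right_cancel₀ this ?_)
    linear_combination s (s (s b)) * hmx - e
  refine ⟨hm, ?_⟩
  by_contra hP
  -- If the coefficient were nonzero, `y / x` would be fixed by `s ^ 3`, and then the original
  -- equations show that it is fixed by `s`.
  have hz : s (s (s x)) * y = s (s (s y)) * x := by
    apply mul_right_cancel₀ hP
    linear_combination y * key x hmx - x * key y hmy
  have hz' := congrArg s hz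
  simp only [map_mul] at hz'
  refine hy (mul_left_cancel₀ hm ?_)
  linear_combination (-s x) * hmy + s y * hmx - hz'

/-- With `k = s m / (s ^ 4 m * b * s b)`, the vanishing of the coefficient of `s ^ 3` in `Φ ^ 3`
says exactly that `s k` is the image of `k` under a Möbius map with coefficients depending only on
`N = b * s ^ 3 b`. -/
theorem exists_mobius_fixed (h6 : ∀ x, s (s (s (s (s (s x))))) = x) {b m : K}
    (hb : b ≠ 0) (hm : m ≠ 0)
    (hP : b * s b * s (s b) * s (s (s (s m))) * s (s (s (s (s m)))) +
      s (s b) * s m * s (s (s (s (s m)))) + b * s (s m) * s (s (s (s m))) +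
      s (s (s (s b))) * s m * s (s m) = 0) :
    ∃ k : K, 1 + k + s k + s (b * s (s (s b))) * k * s k = 0 ∧
      b * s (s (s b)) * s (b * s (s (s b))) * (k * s (s (s k))) = 1 := by
  have hb' : ∀ {c : K}, c ≠ 0 → s c ≠ 0 := fun h => by simpa using h
  have b1 := hb' hb
  have b2 := hb' b1
  have b3 := hb' b2
  have b4 := hb' b3
  have m1 := hb' hm
  have m2 := hb' m1
  have m3 := hb' m2
  have m4 := hb' m3
  have m5 := hb' m4
  refine ⟨s m / (s (s (s (s m))) * b * s b), ?_, ?_⟩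
  · simp only [map_div₀, map_mul]
    generalize s (s (s (s (s m)))) = m₅ at *
    generalize s (s (s (s m))) = m₄ at *
    generalize s (s m) = m₂ at *
    generalize s m = m₁ at *
    generalize s (s (s (s b))) = b₄ at *
    generalize s (s b) = b₂ at *
    generalize s b = b₁ at *
    field_simp
    linear_combination hP
  · simp only [map_div₀, map_mul, h6]
    field_simp

/-- The converse of `exists_mobius_fixed`: since `k * b * s b` has norm one for the involution
`s ^ 3`, Hilbert's theorem 90 recovers `m` from `k`. -/
theorem exists_cubic_coeff_eq_zero [CharP K 2] (h6 : ∀ x, s (s (s (s (s (s x))))) = x) {b k : K}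
    (hk : 1 + k + s k + s (b * s (s (s b))) * k * s k = 0)
    (hk' : b * s (s (s b)) * s (b * s (s (s b))) * (k * s (s (s k))) = 1) :
    ∃ m : K, m ≠ 0 ∧ b * s b * s (s b) * s (s (s (s m))) * s (s (s (s (s m)))) +
      s (s b) * s m * s (s (s (s (s m)))) + b * s (s m) * s (s (s (s m))) +
      s (s (s (s b))) * s m * s (s m) = 0 := by
  obtain ⟨m, hm, h⟩ := exists_div_conj_eq (ρ := k * b * s b) h6 (by
    simp only [map_mul] at hk' ⊢
    linear_combination hk')
  have h' := congrArg s h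
  simp only [map_mul] at h' hk
  refine ⟨m, hm, ?_⟩
  generalize s (s (s (s (s m)))) = m₅ at *
  generalize s (s (s (s m))) = m₄ at *
  rw [h', h]
  linear_combination b * s b * s (s b) * m₄ * m₅ * hk

/-- A solution `k` of the Möbius equation gives a root of the Artin–Schreier equation that is not
fixed by `s ^ 3`: otherwise `k` and its conjugate would coincide, although `B`, which is a nonzero
multiple of their sum, does not vanish. -/
theorem exists_artin_schreier_of_mobius [CharP K 2] {N B k : K}
    (hN : s (s (s N)) = N) (hN1 : N ≠ 1) (hN0 : N ≠ 0)
    (hB' : B = N * s N * s (s N) + N + s N + s (s N)) (hB : B ≠ 0)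
    (hk : 1 + k + s k + s N * k * s k = 0) (hk' : N * s N * (k * s (s (s k))) = 1) :
    ∃ h : K, h ^ 2 + h = N * s N * ((N + 1) * (s N + 1) * (s (s N) + 1)) / B ^ 2 ∧
      s (s (s h)) ≠ h := by
  have two : (2 : K) = 0 := CharTwo.two_eq_zero
  have e₁ := congrArg s hk
  have e₂ := congrArg s e₁
  simp only [map_add, map_mul, map_one, map_zero, hN] at e₁ e₂
  have hq := quadratic_of_mobius hk e₁ e₂ hk'
  rw [← hB'] at hq
  refine ⟨_, artin_schreier_of_quadratic hB hB' hq, ?_⟩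
  have hB3 : s (s (s B)) = B := by simp only [hB', map_add, map_mul, hN]
  simp only [map_div₀, map_mul, map_add, map_one, hN, hB3]
  have h2 : 1 + s (s N) ≠ 0 := by
    intro h
    apply hN1
    have h' : s (1 + s (s N)) = 0 := by rw [h, map_zero]
    simp only [map_add, map_one, hN] at h'
    linear_combination h' - two
  have hs0 : s N ≠ 0 := by simpa using hN0
  intro h
  have hkk : s (s (s k)) = k := by
    have : N * s N * (1 + s (s N)) ≠ 0 := mul_ne_zero (mul_ne_zero hN0 hs0) h2
    field_simp at h
    linear_combination h
  rw [hkk] at hk'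
  have hk0 : k ≠ 0 := by rintro rfl; simp at hk'
  have : B * k = 0 := by linear_combination hq - (1 + s (s N)) * hk' - (1 + s (s N)) * two
  exact mul_ne_zero hB hk0 this

/-- A root of the Artin–Schreier equation that is moved by `s ^ 3` gives a solution of the Möbius
equation. -/
theorem exists_mobius_of_artin_schreier [CharP K 2] (h6 : ∀ x, s (s (s (s (s (s x))))) = x)
    {N B h : K}
    (hN : s (s (s N)) = N) (hN1 : N ≠ 1) (hN0 : N ≠ 0)
    (hB' : B = N * s N * s (s N) + N + s N + s (s N)) (hB : B ≠ 0)
    (hh : h ^ 2 + h = N * s N * ((N + 1) * (s N + 1) * (s (s N) + 1)) / B ^ 2)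
    (hh3 : s (s (s h)) = h + 1) :
    ∃ k : K, 1 + k + s k + s N * k * s k = 0 ∧ N * s N * (k * s (s (s k))) = 1 := by
  have two : (2 : K) = 0 := CharTwo.two_eq_zero
  have s0 : s N ≠ 0 := by simpa using hN0
  have ss0 : s (s N) ≠ 0 := by simpa using hN0
  have n0 : 1 + N ≠ 0 := fun h => hN1 (by linear_combination h - two)
  have n2 : 1 + s (s N) ≠ 0 := by
    intro h
    have h' : s (1 + s (s N)) = 0 := by rw [h, map_zero]
    simp only [map_add, map_one, hN] at h'
    exact n0 h'
  have hBs : s B = B := by simp only [hB', map_add, map_mul, hN]; ring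
  set a := N * s N * (1 + s (s N)) with ha
  have ha0 : a ≠ 0 := mul_ne_zero (mul_ne_zero hN0 s0) n2
  have ha3 : s (s (s a)) = a := by simp only [ha, map_mul, map_add, map_one, hN]
  obtain ⟨k, hk⟩ : ∃ k, k = h * B / a - 1 := ⟨_, rfl⟩
  have hk3 : a * (k + s (s (s k))) = B := by
    have : s (s (s k)) = (h + 1) * B / a - 1 := by
      simp only [hk, map_sub, map_div₀, map_mul, map_one, hBs, hh3, ha3]
    rw [this, hk]
    field_simp
    linear_combination (B * h - a) * two
  have hh' : h = a * (k + 1) / B := by rw [hk]; field_simp; ring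
  rw [hh'] at hh
  have hq := quadratic_of_artin_schreier hB hB' hN0 s0 n2 hh
  rw [← ha] at hq
  have hp : N * s N * (k * s (s (s k))) = 1 := by
    apply mul_left_cancel₀ n2
    linear_combination k * hk3 - hq + k * B * two
  refine ⟨k, ?_, hp⟩
  have hks := congrArg s hk3
  have hps := congrArg s hp
  simp only [map_add, map_mul, map_one, hN, hBs, ha] at hks hps
  refine (mobius_pair hB' s0 ss0 n0 hq hks hps).resolve_right fun hE => ?_
  -- In the second case `s ^ 4 k` is the Möbius image of `k`. As `s ^ 4` acts on `N` like `s` and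
  -- has order three, iterating shows that `k` and `s ^ 3 k` both satisfy `mobius_iterate`.
  have e₁ := congrArg (fun z => s (s (s (s z)))) hE
  have e₂ := congrArg (fun z => s (s (s (s z)))) e₁
  simp only [map_add, map_mul, map_one, map_zero, hN, h6] at e₁ e₂
  have hi := mobius_iterate hE e₁ e₂
  have hi' : s (s (s k)) * (1 + s (s N) + (N + N * s N + s N + s (s N)) * k) =
      (1 + s (s N)) * (1 + k) := by
    have hk0 : k ≠ 0 := by rintro rfl; simp at hp
    have : N * s N * k ≠ 0 := mul_ne_zero (mul_ne_zero hN0 s0) hk0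
    apply mul_left_cancel₀ this
    rw [ha, hB'] at hq
    linear_combination (1 + s (s N) + (N + N * s N + s N + s (s N)) * k) * hp - hq +
      (1 + s (s N) + (N + s N + s (s N)) * k) * two
  have hkk : k - s (s (s k)) ≠ 0 := by
    intro h0
    apply hB
    rw [← hk3, ← sub_eq_zero.1 h0]
    linear_combination a * k * two
  have hD : 1 + s (s N) + (N + N * s N + s N + s (s N)) * k = 0 := by
    apply (mul_eq_zero.1 (?_ : (k - s (s (s k))) * _ = 0)).resolve_left hkk
    linear_combination hi - hi'
  rw [hD, mul_zero] at hi
  have hk1 : k = -1 := by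
    linear_combination (mul_eq_zero.1 hi.symm).resolve_left n2
  apply hkk
  simp [hk1]

/-- When `B = 0` the quadratic for `k` degenerates to `N * s N * k ^ 2 = 1`, and its root always
solves the Möbius equation. -/
theorem exists_mobius_of_eq_zero [CharP K 2] {N : K}
    (hN : s (s (s N)) = N) (hN0 : N ≠ 0)
    (hB : N * s N * s (s N) + N + s N + s (s N) = 0) (hsq : ∃ c : K, c ^ 2 = N * s N) :
    ∃ k : K, 1 + k + s k + s N * k * s k = 0 ∧ N * s N * (k * s (s (s k))) = 1 := by
  have two : (2 : K) = 0 := CharTwo.two_eq_zero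
  have s0 : s N ≠ 0 := by simpa using hN0
  have ss0 : s (s N) ≠ 0 := by simpa using hN0
  obtain ⟨c, hc⟩ := hsq
  have hc0 : c ≠ 0 := by rintro rfl; exact mul_ne_zero hN0 s0 (by rw [← hc]; simp)
  have hcs : s c ^ 2 = s N * s (s N) := by rw [← map_pow, hc, map_mul]
  have hcs0 : s c ≠ 0 := by simpa using hc0
  have inj : ∀ x y : K, x ^ 2 = y ^ 2 → x = y := fun x y h => by
    have : (x - y) ^ 2 = 0 := by linear_combination h - (x * y - y ^ 2) * two
    exact sub_eq_zero.1 (pow_eq_zero_iff two_ne_zero |>.1 this)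
  refine ⟨c⁻¹, ?_, ?_⟩
  · rw [map_inv₀]
    -- Squaring is injective, and the square of the left-hand side is `s N * B`.
    have : c * s c + s c + c + s N = 0 := by
      apply inj
      linear_combination (s c ^ 2 + 1) * hc + (N * s N + 1) * hcs + s N * hB +
        (s c * c * (s c + c + s N) + s c * (c + s N) + c * s N) * two
    field_simp
    linear_combination this
  · have : s (s (s c)) = c := by
      apply inj
      rw [← map_pow, ← map_pow, ← map_pow, hc]
      simp only [map_mul, hN]
    rw [map_inv₀, map_inv₀, map_inv₀, this, ← hc]
    field_simp

end SixCycle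

/-! ### Frobenius, `q`-polynomials and Artin–Schreier equations over finite fields -/

section FiniteFields

/-- The Frobenius endomorphism `x ↦ x ^ q`, where `q = |F|`, of an extension field `K` of the finite
field `F`. -/
noncomputable def qFrob (F K : Type*) [Field F] [Finite F] [Field K] [Algebra F K] : K →ₐ[F] K :=
  letI := Fintype.ofFinite F
  FiniteField.frobeniusAlgHom F K

/-- A `q`-polynomial of `q`-degree less than `[E : F]` that vanishes on all of `E` is zero. -/
theorem coeff_eq_zero_of_forall_sum_pow {F E K : Type*} [Field F] [Finite F] [Field E]
    [Field K] [Algebra F E] [FiniteDimensional F E] [Algebra E K] (a : ℕ → K)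
    (h : ∀ x : E, ∑ i ∈ Finset.range (Module.finrank F E),
      a i * algebraMap E K x ^ (Nat.card F ^ i) = 0) {j : ℕ} (hj : j < Module.finrank F E) :
    a j = 0 := by
  have hfin : Finite E := Module.finite_of_finite F
  let := Fintype.ofFinite E
  have h1 : 1 < Nat.card F := Finite.one_lt_card
  set p : Polynomial K := ∑ i ∈ Finset.range (Module.finrank F E),
    Polynomial.monomial (Nat.card F ^ i) (a i) with hp
  have hp0 : p = 0 := by
    refine Polynomial.eq_zero_of_natDegree_lt_card_of_eval_eq_zero p
      (f := algebraMap E K) (algebraMap E K).injective (fun x => ?_) ?_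
    · simpa [hp, Polynomial.eval_finsetSum] using h x
    · rw [← Nat.card_eq_fintype_card, Module.natCard_eq_pow_finrank (K := F) (V := E)]
      have hpos : 0 < Module.finrank F E := by omega
      refine (Nat.le_sub_one_iff_lt (by positivity)).1 ?_
      refine Polynomial.natDegree_sum_le_of_forall_le _ _ fun i hi => ?_
      refine (Polynomial.natDegree_monomial_le _).trans ?_
      exact Nat.le_sub_one_of_lt (Nat.pow_lt_pow_right h1 (Finset.mem_range.1 hi))
  have := congrArg (fun r => Polynomial.coeff r (Nat.card F ^ j)) hp0
  simp only [hp, Polynomial.finsetSum_coeff, Polynomial.coeff_monomial, Polynomial.coeff_zero,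
    Nat.pow_right_inj h1] at this
  rw [← this]
  simp [hj]

variable {F K : Type*} [Field F] [Finite F] [Field K] [Algebra F K]

theorem qFrob_apply (x : K) : qFrob F K x = x ^ Nat.card F := by
  let := Fintype.ofFinite F
  rw [Nat.card_eq_fintype_card]
  rfl

theorem qFrob_iterate (n : ℕ) (x : K) : (qFrob F K)^[n] x = x ^ (Nat.card F ^ n) := by
  induction n with
  | zero => simp
  | succ n ih => rw [Function.iterate_succ_apply', ih, qFrob_apply, ← pow_mul, pow_succ]

/-- An intermediate field `L` of an extension of finite fields is the set of roots of
`X ^ |L| - X`. -/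
theorem mem_intermediateField_iff_pow_eq [FiniteDimensional F K] (L : IntermediateField F K)
    (x : K) : x ∈ L ↔ x ^ (Nat.card F ^ Module.finrank F L) = x := by
  have hfin : Finite K := Module.finite_of_finite F
  have hcard : Nat.card L = Nat.card F ^ Module.finrank F L := Module.natCard_eq_pow_finrank
  rw [← hcard]
  have h1 : 1 < Nat.card L := Finite.one_lt_card
  have hsub : (L : Set K) ⊆ {x | x ^ Nat.card L = x} := fun x hx => by
    let := Fintype.ofFinite L
    have := congrArg (algebraMap L K) (FiniteField.pow_card (⟨x, hx⟩ : L))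
    rw [← Nat.card_eq_fintype_card] at this
    simpa using this
  have heq := Set.eq_of_subset_of_ncard_le hsub (by
    classical
    have hp : (Polynomial.X ^ Nat.card L - Polynomial.X : Polynomial K) ≠ 0 :=
      FiniteField.X_pow_card_sub_X_ne_zero K h1
    have : {x : K | x ^ Nat.card L = x} =
        ((Polynomial.X ^ Nat.card L - Polynomial.X : Polynomial K).roots.toFinset : Set K) := by
      ext x
      simp [hp, sub_eq_zero]
    rw [this, Set.ncard_coe_finset]
    refine (Multiset.toFinset_card_le _).trans ((Polynomial.card_roots' _).trans ?_)
    rw [FiniteField.X_pow_card_sub_X_natDegree_eq K h1]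
    exact (Nat.card_coe_set_eq _).le) (Set.toFinite _)
  exact Set.ext_iff.1 heq x

theorem sum_artin_schreier_pow {R : Type*} [CommRing R] [CharP R 2] (h : R) (n : ℕ) :
    ∑ i ∈ Finset.range n, (h ^ 2 + h) ^ (2 ^ i) = h ^ 2 ^ n + h := by
  induction n with
  | zero => simp [CharTwo.add_self_eq_zero]
  | succ n ih =>
    rw [Finset.sum_range_succ, ih, add_pow_char_pow, ← pow_mul, ← pow_succ']
    linear_combination (h ^ 2 ^ n) * (CharTwo.two_eq_zero : (2 : R) = 0)

/-- Additive Hilbert 90 for a finite field of characteristic two: the image of `h ↦ h ^ 2 + h` lies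
in the kernel of the absolute trace, and both have codimension one. -/
theorem exists_artin_schreier_root [Finite K] [CharP K 2] (e : K)
    (he : letI := ZMod.algebra K 2; Algebra.trace (ZMod 2) K e = 0) : ∃ h : K, h ^ 2 + h = e := by
  let := ZMod.algebra K 2
  have : Module.Finite (ZMod 2) K := Module.Finite.of_finite
  let g : K →+ K := (frobenius K 2).toAddMonoidHom + AddMonoidHom.id K
  let f : K →ₗ[ZMod 2] K := AddMonoidHom.toZModLinearMap 2 g
  have hf : ∀ h, f h = h ^ 2 + h := fun h => rfl
  have hker : Module.finrank (ZMod 2) (LinearMap.ker f) ≤ 1 := by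
    refine finrank_le_one ⟨1, by simp [LinearMap.mem_ker, hf, CharTwo.add_self_eq_zero]⟩ ?_
    rintro ⟨w, hw⟩
    rw [LinearMap.mem_ker, hf] at hw
    have : w * (w + 1) = 0 := by linear_combination hw
    rcases mul_eq_zero.1 this with h | h
    · exact ⟨0, Subtype.ext (by simp [h])⟩
    · exact ⟨1, Subtype.ext (by simp [CharTwo.add_eq_zero.1 h])⟩
  have hle : LinearMap.range f ≤ LinearMap.ker (Algebra.trace (ZMod 2) K) := by
    rintro _ ⟨h, rfl⟩
    rw [LinearMap.mem_ker]
    apply (algebraMap (ZMod 2) K).injective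
    rw [FiniteField.algebraMap_trace_eq_sum_pow, hf, Nat.card_zmod, sum_artin_schreier_pow,
      map_zero]
    have hc : Nat.card K = 2 ^ Module.finrank (ZMod 2) K := by
      rw [Module.natCard_eq_pow_finrank (K := ZMod 2), Nat.card_zmod]
    rw [← hc]
    let := Fintype.ofFinite K
    rw [Nat.card_eq_fintype_card, FiniteField.pow_card, CharTwo.add_self_eq_zero]
  have hsurj := Algebra.trace_surjective (ZMod 2) K
  have h1 := LinearMap.finrank_range_add_finrank_ker f
  have h2 := LinearMap.finrank_range_add_finrank_ker (Algebra.trace (ZMod 2) K)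
  rw [LinearMap.range_eq_top.2 hsurj, finrank_top, Module.finrank_self] at h2
  have heq := Submodule.eq_of_le_of_finrank_le hle (by omega)
  have : e ∈ LinearMap.range f := by rw [heq]; exact he
  exact this

/-- Over the quadratic extension `K` of a finite field `L` of characteristic two, every equation
`h ^ 2 + h = e` with `e ∈ L` is solvable, and the absolute trace of `e` decides whether the roots
lie in `L`. -/
theorem exists_artin_schreier_root_absTrace {L : Type*} [Field L] [Finite L] [CharP L 2]
    [CharP K 2] [Algebra L K] (h2 : Module.finrank L K = 2) (e : L) :
    ∃ h : K, h ^ 2 + h = algebraMap L K e ∧ (absTrace 2 e = 0 ↔ h ^ Nat.card L = h) := by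
  let := ZMod.algebra K 2
  let := ZMod.algebra L 2
  have : FiniteDimensional L K := FiniteDimensional.of_finrank_pos (by omega)
  have hfin : Finite K := Module.finite_of_finite L
  have hcL : Nat.card L = 2 ^ Module.finrank (ZMod 2) L := by
    rw [Module.natCard_eq_pow_finrank (K := ZMod 2), Nat.card_zmod]
  have hcK : 2 ^ Module.finrank (ZMod 2) K = Nat.card K := by
    rw [Module.natCard_eq_pow_finrank (K := ZMod 2) (V := K), Nat.card_zmod]
  have hd : Module.finrank (ZMod 2) K =
      Module.finrank (ZMod 2) L + Module.finrank (ZMod 2) L := by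
    apply Nat.pow_right_injective le_rfl
    change 2 ^ _ = 2 ^ _
    rw [hcK, pow_add, ← hcL, Module.natCard_eq_pow_finrank (K := L), h2, sq]
  have hpow : e ^ 2 ^ Module.finrank (ZMod 2) L = e := by
    let := Fintype.ofFinite L
    rw [← hcL, Nat.card_eq_fintype_card, FiniteField.pow_card]
  obtain ⟨h, hh⟩ := exists_artin_schreier_root (algebraMap L K e) (by
    apply (algebraMap (ZMod 2) K).injective
    rw [FiniteField.algebraMap_trace_eq_sum_pow, Nat.card_zmod, hd, Finset.sum_range_add,
      map_zero]
    simp only [pow_add 2, pow_mul, ← map_pow, hpow]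
    exact CharTwo.add_self_eq_zero _)
  refine ⟨h, hh, ?_⟩
  have ht : algebraMap L K (algebraMap (ZMod 2) L (absTrace 2 e)) = h ^ Nat.card L + h := by
    rw [absTrace, FiniteField.algebraMap_trace_eq_sum_pow, Nat.card_zmod, map_sum]
    simp only [map_pow, ← hh]
    rw [sum_artin_schreier_pow, hcL]
  rw [← CharTwo.add_eq_zero (a := h ^ Nat.card L), ← ht]
  simp

end FiniteFields

/-! ### Scatteredness in terms of eigenvectors of a `q`-polynomial -/

section Scattered

variable {F K : Type*} [Field F] [Finite F] [Field K] [Algebra F K]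

theorem mem_scatteredU_iff {b : K} {v : K × K} : v ∈ scatteredU F b ↔
    v.2 = b * qFrob F K v.1 +
      qFrob F K (qFrob F K (qFrob F K (qFrob F K v.1))) := by
  have h4 : ∀ x : K, qFrob F K (qFrob F K (qFrob F K (qFrob F K x))) = x ^ (Nat.card F ^ 4) :=
    fun x => qFrob_iterate 4 x
  rw [h4, qFrob_apply]
  constructor
  · rintro ⟨x, rfl⟩
    rfl
  · intro h
    exact ⟨v.1, Prod.ext rfl h⟩

theorem finrank_scatteredU [FiniteDimensional F K] (b : K) :
    Module.finrank F (scatteredU F b) = Module.finrank F K := by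
  let s := (qFrob F K).toLinearMap
  let g : K →ₗ[F] K × K :=
    LinearMap.prod LinearMap.id (LinearMap.mulLeft F b ∘ₗ s + s ∘ₗ s ∘ₗ s ∘ₗ s)
  have hg : LinearMap.range g = scatteredU F b := by
    ext v
    rw [mem_scatteredU_iff]
    constructor
    · rintro ⟨x, rfl⟩
      rfl
    · intro h
      exact ⟨v.1, Prod.ext rfl h.symm⟩
  rw [← hg]
  exact LinearMap.finrank_range_of_inj fun x y h => congrArg Prod.fst h

theorem qFrob_eq_self_iff [FiniteDimensional F K] {x : K} :
    qFrob F K x = x ↔ ∃ c : F, algebraMap F K c = x := by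
  have := mem_intermediateField_iff_pow_eq (⊥ : IntermediateField F K) x
  rw [IntermediateField.finrank_bot, pow_one] at this
  rw [qFrob_apply, ← this]
  exact IntermediateField.mem_bot

/-- The dimension condition is automatic, and a line `K (1, m)` meets `U_b` in the points `(x, m x)`
with `b x ^ q + x ^ (q ^ 4) = m x`. The condition `y * x ^ q = y ^ q * x` says that `y / x` lies in
`F`. The line `K (0, 1)` meets `U_b` trivially. -/
theorem isMaximumScattered_scatteredU_iff [FiniteDimensional F K] (b : K) :
    IsMaximumScattered F K (scatteredU F b) ↔
      ∀ m x y : K, x ≠ 0 →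
        b * qFrob F K x + qFrob F K (qFrob F K (qFrob F K (qFrob F K x))) = m * x →
        b * qFrob F K y + qFrob F K (qFrob F K (qFrob F K (qFrob F K y))) = m * y →
        y * qFrob F K x = qFrob F K y * x := by
  have hdim : 2 * Module.finrank F (scatteredU F b) =
      Module.finrank K (K × K) * Module.finrank F K := by
    rw [finrank_scatteredU, Module.finrank_prod, Module.finrank_self]
  constructor
  · intro h m x y hx hmx hmy
    have h1 := h.1 (1, m) (by simp)
    obtain ⟨v, hv⟩ := finrank_le_one_iff.1 h1
    have mem : ∀ z : K, b * qFrob F K z +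
        qFrob F K (qFrob F K (qFrob F K (qFrob F K z))) = m * z →
        (z, m * z) ∈ scatteredU F b ⊓ (Submodule.span K {((1, m) : K × K)}).restrictScalars F := by
      intro z hz
      refine ⟨mem_scatteredU_iff.2 hz.symm, Submodule.mem_span_singleton.2 ⟨z, ?_⟩⟩
      simp [mul_comm]
    obtain ⟨c, hc⟩ := hv ⟨_, mem x hmx⟩
    obtain ⟨d, hd⟩ := hv ⟨_, mem y hmy⟩
    have hc' : c • (v : K × K).1 = x := congrArg (fun z => z.1.1) hc
    have hd' : d • (v : K × K).1 = y := congrArg (fun z => z.1.1) hd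
    rw [← hc', ← hd', map_smul, map_smul]
    simp only [Algebra.smul_def]
    ring
  · refine fun h => ⟨fun u hu => ?_, hdim⟩
    by_cases hbot : scatteredU F b ⊓ (Submodule.span K {u}).restrictScalars F = ⊥
    · rw [hbot, finrank_bot]
      exact zero_le_one
    obtain ⟨v, hv, hv0⟩ := Submodule.exists_mem_ne_zero_of_ne_bot hbot
    have hvU := mem_scatteredU_iff.1 hv.1
    obtain ⟨a, rfl⟩ := Submodule.mem_span_singleton.1 hv.2
    simp only [Prod.smul_fst, Prod.smul_snd, smul_eq_mul] at hvU
    have hx : a * u.1 ≠ 0 := by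
      intro h0
      apply hv0
      rw [h0] at hvU
      exact Prod.ext h0 (by simpa using hvU)
    have hu1 : u.1 ≠ 0 := right_ne_zero_of_mul hx
    refine finrank_le_one ⟨a • u, hv⟩ ?_
    rintro ⟨w, hw⟩
    have hwU := mem_scatteredU_iff.1 hw.1
    obtain ⟨d, rfl⟩ := Submodule.mem_span_singleton.1 hw.2
    simp only [Prod.smul_fst, Prod.smul_snd, smul_eq_mul] at hwU
    have key := h (u.2 / u.1) (a * u.1) (d * u.1) hx
      (by rw [← hvU]; field_simp) (by rw [← hwU]; field_simp)
    have ha : a ≠ 0 := left_ne_zero_of_mul hx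
    have hfix : qFrob F K (d / a) = d / a := by
      have e : d / a = d * u.1 / (a * u.1) := by field_simp
      have hx' : qFrob F K (a * u.1) ≠ 0 := by simpa using hx
      rw [e, map_div₀, div_eq_div_iff hx' hx, key]
    obtain ⟨c, hc⟩ := qFrob_eq_self_iff.1 hfix
    refine ⟨c, Subtype.ext ?_⟩
    have hd : d = algebraMap F K c * a := by rw [hc]; field_simp
    change c • a • u = d • u
    rw [hd, mul_smul, algebraMap_smul]

variable (L : IntermediateField F K)

theorem qFrob_six (hK : Module.finrank F K = 6) (x : K) :
    qFrob F K (qFrob F K (qFrob F K (qFrob F K (qFrob F K (qFrob F K x))))) = x := by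
  have : FiniteDimensional F K := FiniteDimensional.of_finrank_pos (by omega)
  have h := (mem_intermediateField_iff_pow_eq (⊤ : IntermediateField F K) x).1 trivial
  rw [IntermediateField.finrank_top', hK] at h
  exact (qFrob_iterate 6 x).trans h

variable {L} in
theorem mem_iff_qFrob_three [FiniteDimensional F K] (hL : Module.finrank F L = 3) {x : K} :
    x ∈ L ↔ qFrob F K (qFrob F K (qFrob F K x)) = x := by
  rw [mem_intermediateField_iff_pow_eq, hL, ← qFrob_iterate]
  rfl

/-- If the coefficient of `s ^ 3` in `Φ ^ 3` vanishes, where `Φ x = (b * s x + s ^ 4 x) / m`, then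
`Φ ^ 3` is multiplication by a nonzero scalar of `F`. Rescaling `m` by an element of `L` makes it
the identity, and semilinear descent gives `Φ` a space of fixed points of `F`-dimension two. -/
theorem exists_eigen_pair_of_cubic_coeff (hK : Module.finrank F K = 6)
    (hL : Module.finrank F L = 3) [CharP K 2] {b m : K} (hb : b ≠ 0)
    (hN : b * qFrob F K (qFrob F K (qFrob F K b)) ≠ 1) (hm : m ≠ 0)
    (hP : letI s := qFrob F K
      b * s b * s (s b) * s (s (s (s m))) * s (s (s (s (s m)))) +
      s (s b) * s m * s (s (s (s (s m)))) + b * s (s m) * s (s (s (s m))) +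
      s (s (s (s b))) * s m * s (s m) = 0) :
    ∃ m x y : K, x ≠ 0 ∧
      b * qFrob F K x + qFrob F K (qFrob F K (qFrob F K (qFrob F K x))) = m * x ∧
      b * qFrob F K y + qFrob F K (qFrob F K (qFrob F K (qFrob F K y))) = m * y ∧
      y * qFrob F K x ≠ qFrob F K y * x := by
  have two : (2 : K) = 0 := CharTwo.two_eq_zero
  have : FiniteDimensional F K := FiniteDimensional.of_finrank_pos (by omega)
  have hfin : Finite K := Module.finite_of_finite F
  have h6 := qFrob_six (F := F) (K := K) hK
  have hL3 : ∀ x : K, x ∈ L ↔ _ := fun x => mem_iff_qFrob_three (L := L) hL (x := x)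
  have happ : ∀ i x, (qFrob F K)^[i] x = x ^ (Nat.card F ^ i) := qFrob_iterate
  generalize qFrob F K = s at *
  have h0 : ∀ {c : K}, c ≠ 0 → s c ≠ 0 := fun h => by simpa using h
  have m1 := h0 hm
  have m2 := h0 m1
  have m4 := h0 (h0 m2)
  have m5 := h0 m4
  obtain ⟨Φ, hΦ⟩ : ∃ Φ : K → K, ∀ x, Φ x = (b * s x + s (s (s (s x)))) / m :=
    ⟨_, fun _ => rfl⟩
  have hinj : ∀ x, Φ x = 0 → x = 0 := by
    intro x hx
    rw [hΦ, div_eq_zero_iff, or_iff_left hm] at hx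
    by_contra hx0
    have e := congrArg (fun z => s (s (s z))) hx
    simp only [map_add, map_mul, h6, map_zero] at e
    refine hN (mul_right_cancel₀ (h0 hx0) ?_)
    linear_combination s (s (s b)) * hx - e
  obtain ⟨Q, hQ⟩ : ∃ Q : K, ∀ x, Φ (Φ (Φ x)) = Q * x := by
    refine ⟨(b * s b * s (s (s (s m))) * s (s (s (s (s m)))) + s m * s (s (s (s (s m)))) +
       b * s (s (s (s (s b)))) * s (s m) * s (s (s (s m))) +
       s (s (s (s b))) * s (s (s (s (s b)))) * s m * s (s m)) /
       (m * s m * s (s m) * s (s (s (s m))) * s (s (s (s (s m))))), fun x => ?_⟩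
    simp only [hΦ, map_div₀, map_add, map_mul, h6]
    generalize s (s (s (s (s m)))) = m₅ at *
    generalize s (s (s (s m))) = m₄ at *
    generalize s (s m) = m₂ at *
    generalize s m = m₁ at *
    field_simp
    linear_combination s (s (s x)) * hP
  have hQ0 : Q ≠ 0 := by
    rintro rfl
    exact one_ne_zero (hinj 1 (hinj _ (hinj _ (by rw [hQ, zero_mul]))))
  -- `Φ` commutes with its cube `x ↦ Q * x`; comparing coefficients of the two `q`-polynomials
  -- `Φ (Q * x)` and `Q * Φ x` shows that `Q` lies in `F`.
  have hQs : s Q = Q := by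
    have hcomm : ∀ x, b * (s Q - Q) * s x + (s (s (s (s Q))) - Q) * s (s (s (s x))) = 0 := by
      intro x
      have e : Φ (Q * x) = Q * Φ x := by rw [← hQ, ← hQ]
      simp only [hΦ, map_mul] at e
      field_simp at e
      linear_combination e
    have := coeff_eq_zero_of_forall_sum_pow (F := F) (E := K) (K := K)
      (fun i => if i = 1 then b * (s Q - Q) else if i = 4 then s (s (s (s Q))) - Q else 0)
      (fun x => by
        rw [hK]
        simp only [Algebra.algebraMap_self, RingHom.id_apply, ← happ]
        simpa [Finset.sum_range_succ] using hcomm x) (j := 1) (by omega)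
    simp only [if_true] at this
    exact sub_eq_zero.1 ((mul_eq_zero.1 this).resolve_left hb)
  -- The norm from `L` to `F` is surjective, so `Q` is the norm of some `l` in `L`.
  obtain ⟨l, hl0, hl3, hlQ⟩ : ∃ l : K, l ≠ 0 ∧ s (s (s l)) = l ∧ l * s l * s (s l) = Q := by
    have hQF : Q ∈ (⊥ : IntermediateField F K) := by
      rw [mem_intermediateField_iff_pow_eq, IntermediateField.finrank_bot, ← happ]
      exact hQs
    obtain ⟨c, hc⟩ := IntermediateField.mem_bot.1 hQF
    have : Finite L := Module.finite_of_finite F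
    obtain ⟨l, hl⟩ := FiniteField.norm_surjective F L c
    have hprod := congrArg (algebraMap L K)
      (FiniteField.algebraMap_norm_eq_prod_pow (K := F) (L := L) (x := l))
    rw [hl, hL, ← IsScalarTower.algebraMap_apply, hc, map_prod] at hprod
    simp only [map_pow, ← happ] at hprod
    simp only [Finset.prod_range_succ, Finset.prod_range_zero, one_mul] at hprod
    refine ⟨l, ?_, (hL3 _).1 l.2, hprod.symm⟩
    intro h
    apply hQ0
    rw [hprod]
    change (l : K) * _ * _ = 0
    rw [h, zero_mul, zero_mul]
  have hl1 := h0 hl0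
  have hl2 := h0 hl1
  obtain ⟨Ψ, hΨ⟩ : ∃ Ψ : K → K, ∀ x, Ψ x = Φ x / l := ⟨_, fun _ => rfl⟩
  have hΦl : ∀ c x, s (s (s c)) = c → Φ (c * x) = s c * Φ x := by
    intro c x hc
    simp only [hΦ, map_mul, hc]
    field_simp
  have hΨl : ∀ c x, s (s (s c)) = c → Ψ (c * x) = s c * Ψ x := by
    intro c x hc
    rw [hΨ, hΦl c x hc, hΨ, mul_div_assoc]
  have hΨadd : ∀ x y, Ψ (x + y) = Ψ x + Ψ y := by
    intro x y
    simp only [hΨ, hΦ, map_add]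
    field_simp
    ring
  have hΨ3 : ∀ x, Ψ (Ψ (Ψ x)) = x := by
    intro x
    have hinv : ∀ x, Ψ x = l⁻¹ * Φ x := fun x => by rw [hΨ]; field_simp
    have hli : s (s (s l⁻¹)) = l⁻¹ := by simp only [map_inv₀, hl3]
    have hli' : s (s (s (s l⁻¹))) = s l⁻¹ := by rw [hli]
    rw [hinv x, hΨl _ _ hli, hΨl _ _ hli', hinv, hinv, hΦl _ _ hli, hQ, ← hlQ]
    simp only [map_inv₀]
    field_simp
  by_contra hcon
  push Not at hcon
  have hfix : ∀ x y, Ψ x = x → Ψ y = y → x ≠ 0 → y * s x = s y * x := by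
    intro x y hx hy hx0
    have h' : ∀ z, Ψ z = z → b * s z + s (s (s (s z))) = m * l * z := by
      intro z hz
      nth_rewrite 3 [← hz]
      rw [hΨ, hΦ]
      field_simp
    exact hcon (m * l) x y hx0 (h' x hx) (h' y hy)
  -- If the fixed points of `Ψ` had `F`-dimension at most one, they would all lie in a line `L w`,
  -- which is the kernel of the `L`-linear form `y ↦ y * s ^ 3 w - s ^ 3 y * w`.
  obtain ⟨w, hw0, hw⟩ : ∃ w : K, w ≠ 0 ∧ ∀ y, Ψ y = y → y * s (s (s w)) - s (s (s y)) * w = 0 := by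
    by_cases hex : ∃ w : K, w ≠ 0 ∧ Ψ w = w
    · obtain ⟨w, hw0, hw⟩ := hex
      refine ⟨w, hw0, fun y hy => ?_⟩
      have e := hfix w y hw hy hw0
      have et : s (y / w) = y / w := by
        rw [map_div₀, div_eq_div_iff (h0 hw0) hw0, e]
      have et3 : s (s (s (y / w))) = y / w := by rw [et, et, et]
      simp only [map_div₀] at et3
      rw [div_eq_div_iff (h0 (h0 (h0 hw0))) hw0] at et3
      rw [et3, sub_self]
    · push Not at hex
      refine ⟨1, one_ne_zero, fun y hy => ?_⟩
      have : y = 0 := by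
        by_contra hy0
        exact hex y hy0 hy
      simp [this]
  -- For `c` in `L`, the trace `∑ Ψ ^ i (c * x) = ∑ s ^ i c * Ψ ^ i x` is a fixed point. The form
  -- vanishes on it for all `c`, hence on each `Ψ ^ i x`, in particular on every `x`.
  have hall : ∀ x, x * s (s (s w)) - s (s (s x)) * w = 0 := by
    intro x
    have := coeff_eq_zero_of_forall_sum_pow (F := F) (E := L) (K := K)
      (fun i => Ψ^[i] x * s (s (s w)) - s (s (s (Ψ^[i] x))) * w)
      (fun c => by
        have hc := (hL3 _).1 c.2
        have e := hw (c * x + s c * Ψ x + s (s c) * Ψ (Ψ x)) (by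
          have hc1 : s (s (s (s c))) = s c := by rw [hc]
          have hc2 : s (s (s (s (s c)))) = s (s c) := by rw [hc]
          rw [hΨadd, hΨadd, hΨl _ _ hc, hΨl _ _ hc1, hΨl _ _ hc2, hΨ3, hc]
          ring)
        rw [hL]
        simp only [← happ]
        simp only [Finset.sum_range_succ, Finset.sum_range_zero, zero_add, Function.iterate_succ,
          Function.iterate_zero, Function.comp_apply, id_eq]
        simp only [map_add, map_mul, hc] at e
        change _ * (c : K) + _ * s (c : K) + _ * s (s (c : K)) = 0
        linear_combination e) (j := 0) (by omega)
    exact this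
  have h1 := hall 1
  simp only [map_one, one_mul] at h1
  have htop : L = ⊤ := by
    rw [eq_top_iff]
    intro x _
    rw [hL3]
    apply mul_right_cancel₀ hw0
    linear_combination x * h1 - hall x
  rw [htop, IntermediateField.finrank_top', hK] at hL
  omega

/-- When `b` has norm one, `x ↦ b x ^ q + x ^ (q ^ 4)` vanishes at some `x ≠ 0`, hence on `L x`. -/
theorem exists_eigen_pair_of_norm_eq_one (hK : Module.finrank F K = 6)
    (hL : Module.finrank F L = 3) [CharP K 2] {b : K}
    (hN : b * qFrob F K (qFrob F K (qFrob F K b)) = 1) :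
    ∃ x y : K, x ≠ 0 ∧
      b * qFrob F K x + qFrob F K (qFrob F K (qFrob F K (qFrob F K x))) = 0 * x ∧
      b * qFrob F K y + qFrob F K (qFrob F K (qFrob F K (qFrob F K y))) = 0 * y ∧
      y * qFrob F K x ≠ qFrob F K y * x := by
  have two : (2 : K) = 0 := CharTwo.two_eq_zero
  have : FiniteDimensional F K := FiniteDimensional.of_finrank_pos (by omega)
  have h6 := qFrob_six (F := F) (K := K) hK
  obtain ⟨x, hx, h⟩ := exists_div_conj_eq (s := (qFrob F K : K →+* K)) h6
    (ρ := qFrob F K (qFrob F K (qFrob F K b))) (by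
      simp only [RingHom.coe_coe, h6]
      linear_combination hN)
  simp only [RingHom.coe_coe] at h
  obtain ⟨l, hl, hl'⟩ : ∃ l ∈ L, qFrob F K l ≠ l := by
    by_contra! hcon
    have : L = ⊥ := by
      rw [eq_bot_iff]
      intro l hl
      exact IntermediateField.mem_bot.2 (qFrob_eq_self_iff.1 (hcon l hl))
    rw [this, IntermediateField.finrank_bot] at hL
    omega
  rw [mem_iff_qFrob_three hL] at hl
  have hfx : b * qFrob F K x + qFrob F K (qFrob F K (qFrob F K (qFrob F K x))) = 0 := by
    linear_combination b * h + qFrob F K (qFrob F K (qFrob F K (qFrob F K x))) * (hN + two)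
  refine ⟨x, l * x, hx, by rw [hfx, zero_mul], ?_, ?_⟩
  · simp only [map_mul, hl]
    linear_combination qFrob F K l * hfx
  · intro e
    have hx1 : qFrob F K x ≠ 0 := by simpa using hx
    apply hl'
    apply mul_right_cancel₀ (mul_ne_zero hx hx1)
    rw [map_mul] at e
    linear_combination -e

/-- For `b = 0` and `m = 1` the fixed points form the subfield of order `q ^ 2`. An element of it
outside `F` is found as a relative trace `z + z ^ (q ^ 2) + z ^ (q ^ 4)`. -/
theorem exists_eigen_pair_of_eq_zero (hK : Module.finrank F K = 6) :
    ∃ x y : K, x ≠ 0 ∧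
      0 * qFrob F K x + qFrob F K (qFrob F K (qFrob F K (qFrob F K x))) = 1 * x ∧
      0 * qFrob F K y + qFrob F K (qFrob F K (qFrob F K (qFrob F K y))) = 1 * y ∧
      y * qFrob F K x ≠ qFrob F K y * x := by
  have : FiniteDimensional F K := FiniteDimensional.of_finrank_pos (by omega)
  have h6 := qFrob_six (F := F) (K := K) hK
  by_contra! hcon
  have hz : ∀ z : K, ∑ i ∈ Finset.range 6, (-1) ^ i * (qFrob F K)^[i] z = 0 := by
    intro z
    have e := hcon 1 (z + qFrob F K (qFrob F K z) +
      qFrob F K (qFrob F K (qFrob F K (qFrob F K z)))) one_ne_zero (by simp) (by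
        simp only [map_add, h6]
        ring)
    simp only [map_add, map_one] at e
    simp only [Finset.sum_range_succ, Finset.sum_range_zero, zero_add, Function.iterate_succ,
          Function.iterate_zero, Function.comp_apply, id_eq]
    linear_combination e
  have := coeff_eq_zero_of_forall_sum_pow (F := F) (E := K) (K := K) (fun i => (-1) ^ i)
    (fun x => by
      rw [hK]
      simpa only [Algebra.algebraMap_self, RingHom.id_apply, ← qFrob_iterate] using hz x)
    (j := 0) (by omega)
  simp at this

end Scattered

/-! ### The criterion -/

theorem mainTheorem2 {F K : Type*} [Field F] [Finite F] [CharP F 2] [Field K] [Algebra F K]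
    (hK : Module.finrank F K = 6)
    (L : IntermediateField F K) (hL : Module.finrank F L = 3)
    (q : ℕ) (hq : q = Nat.card F)
    (b N A B C : K)
    (hN : N = Algebra.norm L b)
    (hA : A = b ^ (q + 1))
    (hB : B = N ^ (q ^ 2 + q + 1) + N + N ^ q + N ^ (q ^ 2))
    (hC : C = A ^ (q ^ 3) * (N + 1) ^ (q ^ 2 + q + 1)) :
    ∃ hmem : A * C / B ^ 2 ∈ L,
      IsMaximumScattered F K (scatteredU F b) ↔
        B ≠ 0 ∧ N ≠ 0 ∧ N ≠ 1 ∧ absTrace 2 (⟨A * C / B ^ 2, hmem⟩ : L) = 0 := by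
  have : CharP K 2 := charP_of_injective_algebraMap (algebraMap F K).injective 2
  have two : (2 : K) = 0 := CharTwo.two_eq_zero
  have : FiniteDimensional F K := FiniteDimensional.of_finrank_pos (by omega)
  have hfin : Finite K := Module.finite_of_finite F
  have hfinL : Finite L := Module.finite_of_finite F
  have hLK : Module.finrank L K = 2 := by
    have := Module.finrank_mul_finrank F L K
    rw [hL, hK] at this
    omega
  have hcL : Nat.card L = q ^ 3 := by
    rw [Module.natCard_eq_pow_finrank (K := F), hL, hq]
  have h6 := qFrob_six (F := F) (K := K) hK
  have p1 : ∀ x : K, x ^ q = qFrob F K x := fun x => by rw [qFrob_apply, hq]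
  have p2 : ∀ x : K, x ^ q ^ 2 = qFrob F K (qFrob F K x) := fun x => by
    rw [sq, pow_mul, p1, p1]
  have p3 : ∀ x : K, x ^ q ^ 3 = qFrob F K (qFrob F K (qFrob F K x)) := fun x => by
    rw [pow_succ, pow_mul, p2, p1]
  have hmemL : ∀ {x : K}, x ∈ L ↔ qFrob F K (qFrob F K (qFrob F K x)) = x :=
    mem_iff_qFrob_three hL
  have hNb : N = b * qFrob F K (qFrob F K (qFrob F K b)) := by
    have h := FiniteField.algebraMap_norm_eq_prod_pow (K := L) (L := K) (x := b)
    rw [hLK, hcL, Finset.prod_range_succ, Finset.prod_range_one, pow_zero, pow_one, pow_one,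
      p3] at h
    rw [hN, ← h]
    rfl
  have hN3 : qFrob F K (qFrob F K (qFrob F K N)) = N := by
    rw [hNb]
    simp only [map_mul, h6]
    ring
  simp only [pow_add, pow_one, p1, p2, p3] at hA hB hC
  have hB' : B = N * qFrob F K N * qFrob F K (qFrob F K N) + N + qFrob F K N +
      qFrob F K (qFrob F K N) := by rw [hB]; ring
  have hAC : A * C = N * qFrob F K N *
      ((N + 1) * (qFrob F K N + 1) * (qFrob F K (qFrob F K N) + 1)) := by
    rw [hC, hA, hNb]
    simp only [map_mul, map_add, map_one]
    ring
  have hmem : A * C / B ^ 2 ∈ L := by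
    rw [hmemL, hAC, hB']
    simp only [map_div₀, map_mul, map_add, map_one, map_pow, hN3]
  refine ⟨hmem, ?_⟩
  obtain ⟨h, hh, htr⟩ := exists_artin_schreier_root_absTrace hLK (⟨A * C / B ^ 2, hmem⟩ : L)
  change h ^ 2 + h = A * C / B ^ 2 at hh
  rw [hcL, p3] at htr
  rw [htr, isMaximumScattered_scatteredU_iff]
  have h0N : N = 0 → b = 0 := fun h => by
    rw [hNb, mul_eq_zero] at h
    exact h.elim id (by simp)
  have hroot : ∀ g : K, g ^ 2 + g = A * C / B ^ 2 → g = h ∨ g = h + 1 := by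
    intro g hg
    have : (g - h) * (g - (h + 1)) = 0 := by
      linear_combination hg - hh + (h ^ 2 + h - g * h - g) * two
    rcases mul_eq_zero.1 this with e | e
    · exact Or.inl (sub_eq_zero.1 e)
    · exact Or.inr (sub_eq_zero.1 e)
  constructor
  · intro hsc
    have hN0 : N ≠ 0 := by
      intro h
      obtain ⟨x, y, hx, e₁, e₂, e₃⟩ := exists_eigen_pair_of_eq_zero (F := F) hK
      exact e₃ (hsc 1 x y hx (by rw [h0N h, e₁]) (by rw [h0N h, e₂]))
    have hN1 : N ≠ 1 := by
      intro h
      obtain ⟨x, y, hx, e₁, e₂, e₃⟩ := exists_eigen_pair_of_norm_eq_one L hK hL (hNb ▸ h)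
      exact e₃ (hsc 0 x y hx e₁ e₂)
    have hb : b ≠ 0 := by
      rintro rfl
      exact hN0 (by rw [hNb, zero_mul])
    -- A solution of the Möbius equation produces a line meeting `U_b` in dimension two.
    have hno : ¬ ∃ k : K, 1 + k + qFrob F K k + qFrob F K N * k * qFrob F K k = 0 ∧
        N * qFrob F K N * (k * qFrob F K (qFrob F K (qFrob F K k))) = 1 := by
      rintro ⟨k, hk, hk'⟩
      rw [hNb] at hk hk'
      obtain ⟨m₀, hm₀, hP⟩ :=
        exists_cubic_coeff_eq_zero (s := (qFrob F K : K →+* K)) h6 hk hk'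
      obtain ⟨m, x, y, hx, e₁, e₂, e₃⟩ :=
        exists_eigen_pair_of_cubic_coeff L hK hL hb (hNb ▸ hN1) hm₀ hP
      exact e₃ (hsc m x y hx e₁ e₂)
    have hB0 : B ≠ 0 := by
      intro h
      refine hno (exists_mobius_of_eq_zero (s := (qFrob F K : K →+* K)) hN3 hN0
        (hB'.symm.trans h) ?_)
      obtain ⟨c, hc⟩ := FiniteField.isSquare_of_char_two (CharP.ringChar_of_prime_eq_zero
        Nat.prime_two (by exact_mod_cast two)) (N * qFrob F K N)
      exact ⟨c, by rw [sq]; exact hc.symm⟩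
    refine ⟨hB0, hN0, hN1, ?_⟩
    by_contra hne
    have hh3 : qFrob F K (qFrob F K (qFrob F K h)) = h + 1 := by
      refine (hroot _ ?_).resolve_left hne
      rw [← hmemL.1 hmem, ← hh]
      simp only [map_add, map_pow]
    rw [hAC] at hh
    exact hno (exists_mobius_of_artin_schreier (s := (qFrob F K : K →+* K)) h6 hN3 hN1 hN0 hB'
      hB0 hh hh3)
  · rintro ⟨hB0, hN0, hN1, hh3⟩ m x y hx hmx hmy
    by_contra hne
    have hb : b ≠ 0 := by
      rintro rfl
      exact hN0 (by rw [hNb, zero_mul])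
    obtain ⟨hm, hP⟩ := cubic_coeff_eq_zero (s := (qFrob F K : K →+* K)) h6 (hNb ▸ hN1) hx hne
      hmx hmy
    obtain ⟨k, hk, hk'⟩ := exists_mobius_fixed (s := (qFrob F K : K →+* K)) h6 hb hm hP
    simp only [RingHom.coe_coe, ← hNb] at hk hk'
    obtain ⟨g, hg, hg3⟩ := exists_artin_schreier_of_mobius (s := (qFrob F K : K →+* K)) hN3 hN1
      hN0 hB' hB0 hk hk'
    apply hg3
    simp only [RingHom.coe_coe] at hg ⊢
    rw [← hAC] at hg
    rcases hroot g hg with rfl | rfl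
    · exact hh3
    · simp only [map_add, map_one, hh3]
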